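/- Let $m,n$ be positive integers and suppose that some prime divisor $p$ of $m$ satisfies $n\not\equiv 1\pmod p$. Then $\mathrm{MOD}_m\not\models \mathrm{RC}_n$. Here $\mathrm{RC}_n$ is the axiom: for every infinite set $x$ there are an infinite subset $y\subseteq x$ and a function $f\colon[y]^n\to y$ with $f(z)\in z$ for every $z\in[y]^n$, where $[y]^n$ is the set of all $n$-element subsets of $y$. The permutation model $\mathrm{MOD}_m$ is defined as follows. A model of $\mathrm T_m$ is a set together with a function $\mathrm{Sel}$ that assigns to every finite subset $X$ with more than $m$ elements an $m$-element subset $\mathrm{Sel}(X)\subseteq X$; every subset of a model is the domain of a submodel, with the restricted selection function. Let $\mathbf F$ be a model of $\mathrm T_m$ with domain $\omega$ (it exists, and is unique up to isomorphism) such that every nonempty finite model of $\mathrm T_m$ is isomorphic to infinitely many submodels of $\mathbf F$, and every isomorphism between two finite submodels of $\mathbf F$ extends to an automorphism of $\mathbf F$. The set of atoms is the domain of $\mathbf F$; the group $G$ consists of all permutations $\pi$ of the atoms with $\pi(\mathrm{Sel}(X))=\mathrm{Sel}(\pi X)$ for all finite sets $X$ of atoms with more than $m$ elements. $\mathrm{MOD}_m$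 is the class of all hereditarily symmetric objects of the universe of $\mathrm{ZFA}+\mathrm{AC}$ over these atoms, where $x$ is symmetric if there is a finite set $E$ of atoms (a support) such that $\pi x=x$ for every $\pi\in G$ that fixes $E$ pointwise. -/

import Mathlib

/-! ## Models with a selection function -/

/-- A model of `T_m` with domain `A`: `sel` assigns to every finite subset of `A` with more than `m`
elements one of its `m`-element subsets. The values of `sel` at sets with at most `m` elements carry
no information and are ignored in every definition below. -/
structure SelModel (m : ℕ) (A : Type) where
  sel : Finset A → Finset A
  sel_subset : ∀ X, m < X.card → sel X ⊆ X
  card_sel : ∀ X, m < X.card → (sel X).card = m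

namespace SelModel

variable {m : ℕ} {A B : Type} [DecidableEq A] [DecidableEq B]

/-- `g` restricts to an isomorphism from the submodel of `M` with domain `P` onto the submodel of
`N` with domain `g(P)`. -/
def IsIsoOn (M : SelModel m A) (N : SelModel m B) (g : A → B) (P : Finset A) : Prop :=
  Set.InjOn g P ∧ ∀ X ⊆ P, m < X.card → N.sel (X.image g) = (M.sel X).image g

/-- The group of automorphisms of the model: all permutations `π` of the domain such that
`π (Sel X) = Sel (π X)`. -/
def aut (M : SelModel m A) : Subgroup (Equiv.Perm A) where
  carrier := {π | ∀ X : Finset A, m < X.card → (M.sel X).image π = M.sel (X.image π)}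
  one_mem' := by
    intro X _
    simp
  mul_mem' := by
    intro π ρ hπ hρ X hX
    have h1 := hρ X hX
    have h2 := hπ (X.image ρ) (by rwa [Finset.card_image_of_injective _ ρ.injective])
    rw [Equiv.Perm.coe_mul, ← Finset.image_image, ← Finset.image_image, h1, h2]
  inv_mem' := by
    intro π hπ X hX
    have h := hπ (X.image ⇑π⁻¹) (by rwa [Finset.card_image_of_injective _ (π⁻¹).injective])
    have e1 : (X.image ⇑π⁻¹).image ⇑π = X := by
      rw [Finset.image_image, ← Equiv.Perm.coe_mul]; simp
    rw [e1] at h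
    rw [← h, Finset.image_image, ← Equiv.Perm.coe_mul]; simp

/-- The two defining properties of the (countable) Fraïssé limit of the finite models of `T_m`:
every nonempty finite model is isomorphic to infinitely many submodels of `F`, and every isomorphism
between finite submodels of `F` extends to an automorphism of `F`. -/
structure IsGeneric (F : SelModel m ℕ) : Prop where
  universal : ∀ k : ℕ, 0 < k → ∀ M : SelModel m (Fin k),
    {P : Finset ℕ | ∃ g : Fin k → ℕ, M.IsIsoOn F g Finset.univ ∧
      Finset.univ.image g = P}.Infinite
  homogeneous : ∀ (P : Finset ℕ) (g : ℕ → ℕ), F.IsIsoOn F g P →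
    ∃ π ∈ F.aut, ∀ a ∈ P, π a = g a

/-! ### Existence of a generic model -/

section Existence

/-- A finite table prescribing the selections from sets with largest element `a`: an entry
`(X, b, Y)` asks to select `Y ∪ {a}` (if `b`) or `Y` (otherwise) from `X ∪ {a}`. -/
abbrev Table := Finset (Finset ℕ × Bool × Finset ℕ)

noncomputable def table (a : ℕ) : Table :=
  ((Encodable.decode (α := Table) (Nat.unpair a).1)).getD ∅

theorem exists_table (D : Table) (N : ℕ) : ∃ a, N ≤ a ∧ table a = D :=
  ⟨Nat.pair (Encodable.encode D) N, Nat.right_le_pair _ _, by simp [table]⟩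

/-- Membership in the table of the entry that selects `S` from `X`, where `a = max X`. -/
def Prescribed (m : ℕ) (X S : Finset ℕ) : Prop :=
  S ⊆ X ∧ S.card = m ∧ ∃ b Y, (X.erase (X.sup id), b, Y) ∈ table (X.sup id) ∧
    S = if b = true then insert (X.sup id) Y else Y

open Classical in
/-- A concrete generic model: each `a : ℕ` is coded to be a one-point extension, given by a table,
of a finite set of smaller numbers; selections that no table prescribes are arbitrary. -/
noncomputable def concrete (m : ℕ) : SelModel m ℕ where
  sel X := if h : ∃ S, Prescribed m X S then h.choose else
    if h' : m < X.card then (Finset.exists_subset_card_eq h'.le).choose else ∅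
  sel_subset X hX := by
    split_ifs with h
    · exact h.choose_spec.1
    · exact (Finset.exists_subset_card_eq hX.le).choose_spec.1
  card_sel X hX := by
    split_ifs with h
    · exact h.choose_spec.2.1
    · exact (Finset.exists_subset_card_eq hX.le).choose_spec.2

theorem concrete_sel (X S : Finset ℕ) (h : Prescribed m X S)
    (h' : ∀ S', Prescribed m X S' → S' = S) : (concrete m).sel X = S := by
  have hex : ∃ S, Prescribed m X S := ⟨S, h⟩
  have : (concrete m).sel X = hex.choose := by simp only [concrete, dif_pos hex]
  rw [this]
  exact h' _ hex.choose_spec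

/-- One-point extension of a partial isomorphism into the concrete model. -/
theorem exists_extend (M : SelModel m A) (g : A → ℕ) (P : Finset A)
    (hg : M.IsIsoOn (concrete m) g P) (b : A) (hb : b ∉ P) (N : ℕ) :
    ∃ a, N ≤ a ∧ M.IsIsoOn (concrete m) (Function.update g b a) (insert b P) := by
  classical
  let entry : Finset A → Finset ℕ × Bool × Finset ℕ := fun X =>
    (X.image g, decide (b ∈ M.sel (insert b X)), ((M.sel (insert b X)).erase b).image g)
  obtain ⟨a, ha, hta⟩ := exists_table (P.powerset.image entry) (max N ((P.image g).sup id + 1))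
  have haN : N ≤ a := le_trans (le_max_left _ _) ha
  have haP : ∀ x ∈ P, g x < a := fun x hx =>
    lt_of_lt_of_le (Nat.lt_succ_of_le (Finset.le_sup (f := id) (Finset.mem_image_of_mem g hx)))
      (le_trans (le_max_right _ _) ha)
  have hupd : ∀ x ∈ P, Function.update g b a x = g x := fun x hx =>
    Function.update_of_ne (by rintro rfl; exact hb hx) _ _
  have himg : ∀ X ⊆ P, X.image (Function.update g b a) = X.image g := fun X hX =>
    Finset.image_congr fun x hx => hupd x (hX hx)
  refine ⟨a, haN, ?_, ?_⟩
  · intro x hx y hy hxy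
    simp only [Finset.coe_insert, Set.mem_insert_iff, Finset.mem_coe] at hx hy
    rcases hx with rfl | hx <;> rcases hy with rfl | hy
    · rfl
    · rw [hupd y hy, Function.update_self] at hxy
      exact absurd hxy (haP y hy).ne'
    · rw [hupd x hx, Function.update_self] at hxy
      exact absurd hxy (haP x hx).ne
    · rw [hupd x hx, hupd y hy] at hxy
      exact hg.1 hx hy hxy
  intro Z hZ hcard
  by_cases hbZ : b ∈ Z
  swap
  · have hZP : Z ⊆ P := (Finset.subset_insert_iff_of_notMem hbZ).1 hZ
    have hsel := M.sel_subset Z hcard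
    rw [himg Z hZP, himg _ (hsel.trans hZP)]
    exact hg.2 Z hZP hcard
  obtain ⟨X, hbX, rfl⟩ : ∃ X, b ∉ X ∧ insert b X = Z :=
    ⟨Z.erase b, Finset.notMem_erase _ _, Finset.insert_erase hbZ⟩
  have hXP : X ⊆ P := by
    intro x hx
    have := hZ (Finset.mem_insert_of_mem hx)
    rcases Finset.mem_insert.1 this with rfl | h
    · exact absurd hx hbX
    · exact h
  have hZimg : (insert b X).image (Function.update g b a) = insert a (X.image g) := by
    rw [Finset.image_insert, Function.update_self, himg X hXP]
  have hsup : (insert a (X.image g)).sup id = a := by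
    apply le_antisymm
    · refine Finset.sup_le fun y hy => ?_
      rcases Finset.mem_insert.1 hy with rfl | hy
      · exact le_rfl
      · obtain ⟨x, hx, rfl⟩ := Finset.mem_image.1 hy
        exact (haP x (hXP hx)).le
    · exact Finset.le_sup (f := id) (Finset.mem_insert_self a _)
  have haX : a ∉ X.image g := by
    intro h
    obtain ⟨x, hx, hxa⟩ := Finset.mem_image.1 h
    exact absurd hxa (haP x (hXP hx)).ne
  have hsub := M.sel_subset _ hcard
  have hinj : Set.InjOn (Function.update g b a) (insert b X : Finset A) := by
    intro x hx y hy hxy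
    simp only [Finset.coe_insert, Set.mem_insert_iff, Finset.mem_coe] at hx hy
    rcases hx with rfl | hx <;> rcases hy with rfl | hy
    · rfl
    · rw [hupd y (hXP hy), Function.update_self] at hxy
      exact absurd hxy (haP y (hXP hy)).ne'
    · rw [hupd x (hXP hx), Function.update_self] at hxy
      exact absurd hxy (haP x (hXP hx)).ne
    · rw [hupd x (hXP hx), hupd y (hXP hy)] at hxy
      exact hg.1 (hXP hx) (hXP hy) hxy
  have hcand : (M.sel (insert b X)).image (Function.update g b a) =
      if decide (b ∈ M.sel (insert b X)) = true then
        insert a (((M.sel (insert b X)).erase b).image g)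
      else ((M.sel (insert b X)).erase b).image g := by
    have herase : (M.sel (insert b X)).erase b ⊆ P := by
      intro x hx
      rcases Finset.mem_insert.1 (hsub (Finset.mem_of_mem_erase hx)) with rfl | h
      · exact absurd hx (Finset.notMem_erase _ _)
      · exact hXP h
    by_cases hbs : b ∈ M.sel (insert b X)
    · simp only [hbs, decide_true, if_true]
      conv_lhs => rw [← Finset.insert_erase hbs]
      rw [Finset.image_insert, Function.update_self, himg _ herase]
    · simp only [hbs, decide_false, Bool.false_eq_true, if_false]
      conv_lhs => rw [← Finset.erase_eq_of_notMem hbs]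
      rw [himg _ herase]
  apply concrete_sel
  · refine ⟨Finset.image_subset_image hsub, ?_, ?_⟩
    · rw [Finset.card_image_of_injOn (hinj.mono (by exact_mod_cast hsub)), M.card_sel _ hcard]
    · rw [hZimg, hsup, Finset.erase_insert haX, hta]
      exact ⟨_, _, Finset.mem_image.2 ⟨X, Finset.mem_powerset.2 hXP, rfl⟩, hcand⟩
  · rintro S' ⟨-, -, b', Y, hmem, rfl⟩
    rw [hZimg, hsup, Finset.erase_insert haX, hta] at hmem
    obtain ⟨X', hX', he⟩ := Finset.mem_image.1 hmem
    have hX'P := Finset.mem_powerset.1 hX'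
    simp only [entry, Prod.mk.injEq] at he
    have hXX : X' = X := by
      have h1 := he.1
      ext x
      constructor
      · intro hx
        have : g x ∈ X.image g := h1 ▸ Finset.mem_image_of_mem g hx
        obtain ⟨y, hy, hyx⟩ := Finset.mem_image.1 this
        exact hg.1 (hXP hy) (hX'P hx) hyx ▸ hy
      · intro hx
        have : g x ∈ X'.image g := h1.symm ▸ Finset.mem_image_of_mem g hx
        obtain ⟨y, hy, hyx⟩ := Finset.mem_image.1 this
        exact hg.1 (hX'P hy) (hXP hx) hyx ▸ hy
    subst hXX
    rw [hZimg, hsup, hcand, he.2.1, he.2.2]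

/-- A finite partial isomorphism, as a set of pairs. -/
def PI (F : SelModel m ℕ) (R : Finset (ℕ × ℕ)) : Prop :=
  (∀ p ∈ R, ∀ q ∈ R, p.1 = q.1 ↔ p.2 = q.2) ∧
  ∀ X ⊆ R, m < X.card → ∀ p ∈ X, p.1 ∈ F.sel (X.image Prod.fst) ↔ p.2 ∈ F.sel (X.image Prod.snd)

theorem PI.swap {F : SelModel m ℕ} {R : Finset (ℕ × ℕ)} (h : F.PI R) :
    F.PI (R.image Prod.swap) := by
  have key : ∀ p, p ∈ R.image Prod.swap ↔ p.swap ∈ R := by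
    intro p
    rw [Finset.mem_image]
    constructor
    · rintro ⟨q, hq, rfl⟩
      simpa using hq
    · intro hp
      exact ⟨p.swap, hp, by simp⟩
  refine ⟨fun p hp q hq => ?_, fun X hX hc p hp => ?_⟩
  · exact (h.1 _ ((key p).1 hp) _ ((key q).1 hq)).symm
  · have hX' : X.image Prod.swap ⊆ R := by
      intro q hq
      obtain ⟨r, hr, rfl⟩ := Finset.mem_image.1 hq
      exact (key r).1 (hX hr)
    have := h.2 (X.image Prod.swap) hX'
      (by rwa [Finset.card_image_of_injective _ Prod.swap_injective]) p.swap
      (Finset.mem_image_of_mem _ hp)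
    rw [Finset.image_image, Finset.image_image] at this
    exact this.symm

theorem isIsoOn_iff_PI {F : SelModel m ℕ} {g : ℕ → ℕ} {P : Finset ℕ} (h : F.IsIsoOn F g P) :
    F.PI (P.image fun a => (a, g a)) := by
  refine ⟨?_, ?_⟩
  · intro p hp q hq
    obtain ⟨a, ha, rfl⟩ := Finset.mem_image.1 hp
    obtain ⟨b, hb, rfl⟩ := Finset.mem_image.1 hq
    exact ⟨fun e => congrArg g e, fun e => h.1 ha hb e⟩
  · intro X hX hc p hp
    have hXe : X = (X.image Prod.fst).image fun a => (a, g a) := by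
      rw [Finset.image_image]
      conv_lhs => rw [← Finset.image_id (s := X)]
      refine Finset.image_congr fun q hq => ?_
      obtain ⟨a, -, rfl⟩ := Finset.mem_image.1 (hX hq)
      rfl
    set Z := X.image Prod.fst with hZ
    have hZP : Z ⊆ P := by
      intro a ha
      obtain ⟨q, hq, rfl⟩ := Finset.mem_image.1 ha
      obtain ⟨a, haP, rfl⟩ := Finset.mem_image.1 (hX hq)
      exact haP
    have hcZ : m < Z.card := by
      rw [hXe] at hc
      exact lt_of_lt_of_le hc Finset.card_image_le
    have h2 : X.image Prod.snd = Z.image g := by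
      rw [hXe, Finset.image_image]; rfl
    rw [h2, h.2 Z hZP hcZ]
    obtain ⟨a, haP, rfl⟩ := Finset.mem_image.1 (hX hp)
    constructor
    · exact fun ha => Finset.mem_image_of_mem g ha
    · intro ha
      obtain ⟨c, hc', hca⟩ := Finset.mem_image.1 ha
      have := h.1 (hZP (F.sel_subset Z hcZ hc')) haP hca
      exact this ▸ hc'

theorem PI.exists_fun {F : SelModel m ℕ} {R : Finset (ℕ × ℕ)} (h : F.PI R) :
    ∃ g : ℕ → ℕ, F.IsIsoOn F g (R.image Prod.fst) ∧ ∀ p ∈ R, g p.1 = p.2 := by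
  classical
  let g : ℕ → ℕ := fun a => if h : ∃ b, (a, b) ∈ R then h.choose else 0
  have hg : ∀ p ∈ R, g p.1 = p.2 := by
    intro p hp
    have hex : ∃ b, (p.1, b) ∈ R := ⟨p.2, hp⟩
    have : g p.1 = hex.choose := dif_pos hex
    rw [this]
    exact (h.1 _ hex.choose_spec _ hp).1 rfl
  refine ⟨g, ⟨?_, ?_⟩, hg⟩
  · intro a ha b hb hab
    obtain ⟨p, hp, rfl⟩ := Finset.mem_image.1 ha
    obtain ⟨q, hq, rfl⟩ := Finset.mem_image.1 hb
    rw [hg p hp, hg q hq] at hab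
    exact (h.1 p hp q hq).2 hab
  · intro X hX hc
    let Z := X.image fun a => (a, g a)
    have hZ : Z ⊆ R := by
      intro p hp
      obtain ⟨a, ha, rfl⟩ := Finset.mem_image.1 hp
      obtain ⟨q, hq, rfl⟩ := Finset.mem_image.1 (hX ha)
      rw [hg q hq]
      exact hq
    have hc' : Z.card = X.card :=
      Finset.card_image_of_injective _ fun a b e => (Prod.mk.inj e).1
    have h1 : Z.image Prod.fst = X := by
      simp only [Z, Finset.image_image]
      exact Finset.image_id
    have h2 : Z.image Prod.snd = X.image g := by
      simp only [Z, Finset.image_image]; rfl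
    have key := h.2 Z hZ (hc'.symm ▸ hc)
    rw [h1, h2] at key
    have hinj : Set.InjOn g X := by
      intro a ha b hb hab
      obtain ⟨p, hp, rfl⟩ := Finset.mem_image.1 (hX ha)
      obtain ⟨q, hq, rfl⟩ := Finset.mem_image.1 (hX hb)
      rw [hg p hp, hg q hq] at hab
      exact (h.1 p hp q hq).2 hab
    have hcg : m < (X.image g).card := by rwa [Finset.card_image_of_injOn hinj]
    ext b
    constructor
    · intro hb
      obtain ⟨a, ha, rfl⟩ := Finset.mem_image.1 (F.sel_subset _ hcg hb)
      exact Finset.mem_image_of_mem g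
        ((key (a, g a) (Finset.mem_image.2 ⟨a, ha, rfl⟩)).2 hb)
    · intro hb
      obtain ⟨a, ha, rfl⟩ := Finset.mem_image.1 hb
      exact (key (a, g a) (Finset.mem_image.2 ⟨a, F.sel_subset _ hc ha, rfl⟩)).1 ha

theorem PI.forth {R : Finset (ℕ × ℕ)} (h : (concrete m).PI R) (a : ℕ) :
    ∃ R', R ⊆ R' ∧ (concrete m).PI R' ∧ ∃ b, (a, b) ∈ R' := by
  by_cases ha : a ∈ R.image Prod.fst
  · obtain ⟨p, hp, rfl⟩ := Finset.mem_image.1 ha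
    exact ⟨R, subset_rfl, h, p.2, hp⟩
  obtain ⟨g, hg, hgR⟩ := h.exists_fun
  obtain ⟨b, -, hb⟩ := exists_extend _ g _ hg a ha 0
  refine ⟨_, ?_, isIsoOn_iff_PI hb, b, ?_⟩
  · intro p hp
    have hp1 := Finset.mem_image_of_mem Prod.fst hp
    refine Finset.mem_image.2 ⟨p.1, Finset.mem_insert_of_mem hp1, ?_⟩
    have hne : p.1 ≠ a := by
      rintro rfl
      exact ha hp1
    rw [Function.update_of_ne hne, hgR p hp]
  · exact Finset.mem_image.2 ⟨a, Finset.mem_insert_self _ _, by rw [Function.update_self]⟩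

theorem PI.back {R : Finset (ℕ × ℕ)} (h : (concrete m).PI R) (b : ℕ) :
    ∃ R', R ⊆ R' ∧ (concrete m).PI R' ∧ ∃ a, (a, b) ∈ R' := by
  obtain ⟨R', hR, hPI, a, ha⟩ := h.swap.forth b
  refine ⟨R'.image Prod.swap, ?_, hPI.swap, a, ?_⟩
  · intro p hp
    exact Finset.mem_image.2 ⟨p.swap, hR (Finset.mem_image_of_mem _ hp), by simp⟩
  · exact Finset.mem_image.2 ⟨(b, a), ha, rfl⟩

theorem PI.step {R : Finset (ℕ × ℕ)} (h : (concrete m).PI R) (k : ℕ) :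
    ∃ R', R ⊆ R' ∧ (concrete m).PI R' ∧ (∃ b, (k, b) ∈ R') ∧ ∃ a, (a, k) ∈ R' := by
  obtain ⟨R1, h1, hPI1, b, hb⟩ := h.forth k
  obtain ⟨R2, h2, hPI2, a, ha⟩ := hPI1.back k
  exact ⟨R2, h1.trans h2, hPI2, ⟨b, h2 hb⟩, a, ha⟩

/-- The back-and-forth sequence of finite partial isomorphisms. -/
noncomputable def chain (R : {R : Finset (ℕ × ℕ) // (concrete m).PI R}) :
    ℕ → {R : Finset (ℕ × ℕ) // (concrete m).PI R}
  | 0 => R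
  | k + 1 => ⟨((chain R k).2.step k).choose, ((chain R k).2.step k).choose_spec.2.1⟩

theorem concrete_homogeneous (P : Finset ℕ) (g : ℕ → ℕ)
    (h : (concrete m).IsIsoOn (concrete m) g P) :
    ∃ π ∈ (concrete m).aut, ∀ a ∈ P, π a = g a := by
  classical
  let c := chain (m := m) ⟨_, isIsoOn_iff_PI h⟩
  have hstep : ∀ k, (c k).1 ⊆ (c (k + 1)).1 := fun k => ((c k).2.step k).choose_spec.1
  have hmono : Monotone fun k => (c k).1 := monotone_nat_of_le_succ hstep
  have hdom : ∀ k, ∃ b, (k, b) ∈ (c (k + 1)).1 := fun k => ((c k).2.step k).choose_spec.2.2.1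
  have hran : ∀ k, ∃ a, (a, k) ∈ (c (k + 1)).1 := fun k => ((c k).2.step k).choose_spec.2.2.2
  have huniq : ∀ i j p q, p ∈ (c i).1 → q ∈ (c j).1 → (p.1 = q.1 ↔ p.2 = q.2) := by
    intro i j p q hp hq
    exact (c (max i j)).2.1 p (hmono (le_max_left i j) hp) q (hmono (le_max_right i j) hq)
  choose f hf using hdom
  choose f' hf' using hran
  let π : Equiv.Perm ℕ :=
    { toFun := f
      invFun := f'
      left_inv := fun a => (huniq _ _ _ _ (hf' (f a)) (hf a)).2 rfl
      right_inv := fun b => (huniq _ _ _ _ (hf (f' b)) (hf' b)).1 rfl }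
  have hπ : ∀ i, ∀ p ∈ (c i).1, π p.1 = p.2 := fun i p hp => (huniq _ _ _ _ (hf p.1) hp).1 rfl
  refine ⟨π, ?_, ?_⟩
  · intro X hX
    obtain ⟨g', hg', hgR⟩ := (c (X.sup id + 1)).2.exists_fun
    have hmem : ∀ a ∈ X, (a, π a) ∈ (c (X.sup id + 1)).1 := fun a ha =>
      hmono (Nat.succ_le_succ (Finset.le_sup (f := id) ha)) (hf a)
    have hsub : X ⊆ (c (X.sup id + 1)).1.image Prod.fst := fun a ha =>
      Finset.mem_image.2 ⟨_, hmem a ha, rfl⟩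
    have hEq : ∀ a ∈ X, g' a = π a := fun a ha => hgR _ (hmem a ha)
    have := hg'.2 X hsub hX
    have e1 : X.image g' = X.image π := Finset.image_congr fun a ha => hEq a ha
    have e2 : ((concrete m).sel X).image g' = ((concrete m).sel X).image π :=
      Finset.image_congr fun a ha => hEq a ((concrete m).sel_subset X hX ha)
    rw [e1, e2] at this
    exact this.symm
  · intro a ha
    exact hπ 0 (a, g a) (Finset.mem_image.2 ⟨a, ha, rfl⟩)

theorem concrete_universal (k : ℕ) (hk : 0 < k) (M : SelModel m (Fin k)) :
    {P : Finset ℕ | ∃ g : Fin k → ℕ, M.IsIsoOn (concrete m) g Finset.univ ∧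
      Finset.univ.image g = P}.Infinite := by
  have key : ∀ N : ℕ, ∀ P : Finset (Fin k), ∃ g : Fin k → ℕ, M.IsIsoOn (concrete m) g P ∧
      ∀ x ∈ P, N ≤ g x := by
    intro N P
    induction P using Finset.induction_on with
    | empty =>
      refine ⟨fun _ => 0, ⟨by simp, ?_⟩, by simp⟩
      intro X hX hc
      rw [Finset.subset_empty.1 hX] at hc
      simp at hc
    | insert b P hb ih =>
      obtain ⟨g, hg, hN⟩ := ih
      obtain ⟨a, ha, h⟩ := exists_extend M g P hg b hb N
      refine ⟨_, h, ?_⟩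
      intro x hx
      rcases Finset.mem_insert.1 hx with rfl | hxP
      · rwa [Function.update_self]
      · have hne : x ≠ b := by
          rintro rfl
          exact hb hxP
        rw [Function.update_of_ne hne]
        exact hN x hxP
  intro hfin
  obtain ⟨g, hg, hN⟩ := key ((hfin.toFinset.sup fun P => P.sup id) + 1) Finset.univ
  have h1 : Finset.univ.image g ∈ hfin.toFinset := hfin.mem_toFinset.2 ⟨g, hg, rfl⟩
  have h2 : g ⟨0, hk⟩ ≤ (Finset.univ.image g).sup id :=
    Finset.le_sup (f := id) (Finset.mem_image_of_mem g (Finset.mem_univ _))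
  have h3 : (Finset.univ.image g).sup id ≤ hfin.toFinset.sup fun P => P.sup id :=
    Finset.le_sup (f := fun P : Finset ℕ => P.sup id) h1
  have h4 := hN ⟨0, hk⟩ (Finset.mem_univ _)
  omega

/-- Generic models exist. -/
theorem exists_isGeneric (m : ℕ) : ∃ F : SelModel m ℕ, F.IsGeneric :=
  ⟨concrete m, concrete_universal, concrete_homogeneous⟩

end Existence

end SelModel

/-! ## The universe of sets over a set of atoms -/

universe u

/-- Well-founded trees whose leaves may be atoms; names for the sets over the atoms `A`. -/
inductive PreZFA (A : Type) : Type (u + 1)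
  | atom (a : A) : PreZFA A
  | set (ι : Type u) (f : ι → PreZFA A) : PreZFA A

namespace PreZFA

variable {A : Type}

/-- Two names denote the same object: equal atoms, or sets with the same elements. An atom is never
equal to a set (in particular not to the empty set). -/
def Equiv : PreZFA.{u} A → PreZFA.{u} A → Prop
  | atom a, atom b => a = b
  | set _ f, set _ g => (∀ i, ∃ j, Equiv (f i) (g j)) ∧ ∀ j, ∃ i, Equiv (f i) (g j)
  | atom _, set _ _ => False
  | set _ _, atom _ => False

theorem Equiv.refl (x : PreZFA.{u} A) : Equiv x x := by
  induction x with
  | atom a => simp [Equiv]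
  | set ι f ih => exact ⟨fun i => ⟨i, ih i⟩, fun i => ⟨i, ih i⟩⟩

theorem Equiv.symm {x y : PreZFA.{u} A} (h : Equiv x y) : Equiv y x := by
  induction x generalizing y with
  | atom a => cases y with
    | atom b => exact Eq.symm h
    | set κ g => exact h
  | set ι f ih => cases y with
    | atom b => exact h
    | set κ g =>
      refine ⟨fun j => ?_, fun i => ?_⟩
      · obtain ⟨i, hi⟩ := h.2 j
        exact ⟨i, ih i hi⟩
      · obtain ⟨j, hj⟩ := h.1 i
        exact ⟨j, ih i hj⟩

theorem Equiv.trans {x y z : PreZFA.{u} A} (h : Equiv x y) (h' : Equiv y z) : Equiv x z := by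
  induction x generalizing y z with
  | atom a => cases y with
    | atom b => cases z with
      | atom c => exact Eq.trans h h'
      | set κ g => exact h'
    | set κ g => exact h.elim
  | set ι f ih => cases y with
    | atom b => exact h.elim
    | set κ g => cases z with
      | atom c => exact h'
      | set μ k =>
        refine ⟨fun i => ?_, fun l => ?_⟩
        · obtain ⟨j, hj⟩ := h.1 i
          obtain ⟨l, hl⟩ := h'.1 j
          exact ⟨l, ih i hj hl⟩
        · obtain ⟨j, hj⟩ := h'.2 l
          obtain ⟨i, hi⟩ := h.2 j
          exact ⟨i, ih i hi hj⟩

instance setoid (A : Type) : Setoid (PreZFA.{u} A) :=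
  ⟨Equiv, Equiv.refl, Equiv.symm, Equiv.trans⟩

/-- `x` is an element of `y`; atoms have no elements. -/
def Mem (x : PreZFA.{u} A) : PreZFA.{u} A → Prop
  | atom _ => False
  | set _ f => ∃ i, Equiv x (f i)

def IsAtom : PreZFA.{u} A → Prop
  | atom _ => True
  | set _ _ => False

/-- The action of a permutation of the atoms: `π x = {π y : y ∈ x}` for sets `x`. -/
def map (π : Equiv.Perm A) : PreZFA.{u} A → PreZFA.{u} A
  | atom a => atom (π a)
  | set ι f => set ι fun i => map π (f i)

theorem Mem.congr {x x' y y' : PreZFA.{u} A} (hx : Equiv x x') (hy : Equiv y y')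
    (h : Mem x y) : Mem x' y' := by
  cases y with
  | atom b => exact h.elim
  | set ι f => cases y' with
    | atom b => exact hy.elim
    | set κ g =>
      obtain ⟨i, hi⟩ := h
      obtain ⟨j, hj⟩ := hy.1 i
      exact ⟨j, hx.symm.trans (hi.trans hj)⟩

theorem IsAtom.congr {x y : PreZFA.{u} A} (h : Equiv x y) (hx : IsAtom x) : IsAtom y := by
  cases x with
  | atom a => cases y with
    | atom b => exact trivial
    | set κ g => exact h
  | set ι f => exact hx.elim

theorem map_congr (π : Equiv.Perm A) {x y : PreZFA.{u} A} (h : Equiv x y) :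
    Equiv (map π x) (map π y) := by
  induction x generalizing y with
  | atom a => cases y with
    | atom b => exact congrArg π h
    | set κ g => exact h
  | set ι f ih => cases y with
    | atom b => exact h
    | set κ g =>
      refine ⟨fun i => ?_, fun j => ?_⟩
      · obtain ⟨j, hj⟩ := h.1 i
        exact ⟨j, ih i hj⟩
      · obtain ⟨i, hi⟩ := h.2 j
        exact ⟨i, ih i hi⟩

end PreZFA

/-- The universe of all sets and atoms over the set of atoms `A`: the standard ground model of
`ZFA + AC` (the cumulative hierarchy over `A`), built over `Type u`. -/
def ZFA (A : Type) : Type (u + 1) := Quotient (PreZFA.setoid.{u} A)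

namespace ZFA

variable {A : Type}

/-- Membership. -/
def Mem : ZFA.{u} A → ZFA.{u} A → Prop :=
  Quotient.lift₂ PreZFA.Mem fun _ _ _ _ hx hy =>
    propext ⟨PreZFA.Mem.congr hx hy, PreZFA.Mem.congr hx.symm hy.symm⟩

def IsAtom : ZFA.{u} A → Prop :=
  Quotient.lift PreZFA.IsAtom fun _ _ h =>
    propext ⟨PreZFA.IsAtom.congr h, PreZFA.IsAtom.congr h.symm⟩

/-- The action of a permutation of the atoms on the universe. -/
def map (π : Equiv.Perm A) : ZFA.{u} A → ZFA.{u} A :=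
  Quotient.map (PreZFA.map π) fun _ _ h => PreZFA.map_congr π h

/-- The symmetry group of `x` in `G` belongs to the normal filter generated by the pointwise
stabilizers `fix_G(E)` of the finite sets `E` of atoms; `E` is a support of `x`. -/
def IsSymmetric (G : Subgroup (Equiv.Perm A)) (x : ZFA.{u} A) : Prop :=
  ∃ E : Finset A, ∀ π ∈ G, (∀ a ∈ E, π a = a) → map π x = x

/-- `x` and all the elements of its transitive closure are symmetric. -/
inductive IsHereditarilySymmetric (G : Subgroup (Equiv.Perm A)) : ZFA.{u} A → Prop
  | intro (x : ZFA.{u} A) (hx : IsSymmetric G x)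
      (h : ∀ y, Mem y x → IsHereditarilySymmetric G y) : IsHereditarilySymmetric G x

end ZFA

/-! ## Permutation models and Ramsey choice -/

/-- A structure for the language of set theory with atoms. -/
structure SetStructure where
  carrier : Type u
  mem : carrier → carrier → Prop
  isAtom : carrier → Prop

namespace SetStructure

variable (M : SetStructure.{u})

/-- In `M`, `c = {a, b}`. -/
def IsUPair (c a b : M.carrier) : Prop :=
  ¬ M.isAtom c ∧ ∀ t, M.mem t c ↔ t = a ∨ t = b

/-- In `M`, `q` is the ordered (Kuratowski) pair `(a, b)`. -/
def IsPair (q a b : M.carrier) : Prop :=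
  ∃ c d, M.IsUPair c a a ∧ M.IsUPair d a b ∧ M.IsUPair q c d

/-- In `M`, `x` is an infinite set. In a permutation model finiteness is absolute, because every
enumeration of a finite set of the model has a finite support. -/
def IsInfiniteSet (x : M.carrier) : Prop :=
  ¬ M.isAtom x ∧ {t | M.mem t x}.Infinite

/-- In `M`, `y` is a set that is a subset of `x`. -/
def IsSubset (y x : M.carrier) : Prop :=
  ¬ M.isAtom y ∧ ∀ t, M.mem t y → M.mem t x

/-- In `M`, `z` is an element of `[y]^n`: a subset of `y` with exactly `n` elements. -/
def IsSubsetOfCard (n : ℕ) (z y : M.carrier) : Prop :=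
  M.IsSubset z y ∧ {t | M.mem t z}.Finite ∧ {t | M.mem t z}.ncard = n

/-- In `M`, `f` is a function with domain `[y]^n` such that `f(z) ∈ z` for all `z ∈ [y]^n`. -/
def IsChoiceFunction (n : ℕ) (f y : M.carrier) : Prop :=
  ¬ M.isAtom f ∧
  (∀ q, M.mem q f → ∃ z w, M.IsSubsetOfCard n z y ∧ M.mem w z ∧ M.IsPair q z w) ∧
  ∀ z, M.IsSubsetOfCard n z y → ∃! w, ∃ q, M.mem q f ∧ M.IsPair q z w

/-- `M ⊨ RC_n`: every infinite set `x` has an infinite subset `y` such that there is a choice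
function on `[y]^n`. All the objects `x`, `y`, `f` belong to `M`. -/
def RC (n : ℕ) : Prop :=
  ∀ x, M.IsInfiniteSet x →
    ∃ y, M.IsSubset y x ∧ M.IsInfiniteSet y ∧ ∃ f, M.IsChoiceFunction n f y

end SetStructure

/-- The permutation model determined by a group `G` of permutations of the atoms and the normal
ideal of finite sets of atoms. -/
def permutationModel {A : Type} (G : Subgroup (Equiv.Perm A)) : SetStructure.{u + 1} where
  carrier := {x : ZFA.{u} A // ZFA.IsHereditarilySymmetric G x}
  mem x y := ZFA.Mem x.1 y.1
  isAtom x := ZFA.IsAtom x.1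

/-- The model `MOD_m`, with atoms the elements of the generic model `F` of `T_m`, and the group of
the automorphisms of `F`. -/
def MOD {m : ℕ} (F : SelModel m ℕ) : SetStructure.{u + 1} := permutationModel.{u} F.aut

/-! A choice function on `[y]^n` with finite support `E` must choose, from every `n`-set of atoms of
`y`, an atom fixed by all automorphisms that fix `E` pointwise and preserve the set. So it suffices
to find an `n`-set in `y` on which such automorphisms have no common fixed point.

Fix an atom `b` of `y` outside a common support `E` of `y` and the choice function. Arrange `n` new
points in `n / p` cycles of length `p` and a tail of `n % p` points; let a group rotate all cycles
simultaneously, permute the tail and fix `E`. It has no fixed new point because `n % p ≠ 1`. What is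
needed is a model of `T_m` on `E` and the new points that is invariant under this group and in which
each new point looks over `E` like `b`. Embedded in `F` over `E`, its new points lie in `y` by
homogeneity, and the group elements extend to automorphisms of `F`.

An invariant selection exists as soon as each `X` with more than `m` elements has an `m`-subset
preserved by the stabilizer of `X` (`SelModel.exists_equivariant`). Finding this subset is the
combinatorial core (`rotationGroup_exists_invariant`): it uses `p ∣ m` and that the tail has fewer
than `p` points. -/

/-! ### Equivariant selections -/

open scoped Pointwise in
/-- Equivariant selection: if every `X` with more than `m` elements has an `m`-element subset that
satisfies an invariant condition `P` and is fixed by the stabilizer of `X`, then such subsets can be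
chosen equivariantly. -/
theorem SelModel.exists_equivariant {m : ℕ} {D : Type} [DecidableEq D] {H : Type*} [Group H]
    [MulAction H D] (P : Finset D → Finset D → Prop)
    (hP : ∀ (h : H) X S, P X S → P (h • X) (h • S))
    (hS : ∀ X : Finset D, m < X.card → ∃ S ⊆ X, S.card = m ∧ P X S ∧
      ∀ h : H, h • X = X → h • S = S) :
    ∃ M : SelModel m D, (∀ X, m < X.card → P X (M.sel X)) ∧
      ∀ (h : H) X, m < X.card → M.sel (h • X) = h • M.sel X := by
  choose! S hsub hcard hPS hstab using hS
  -- One representative per orbit; the selection at `X` is transported from it by some `t X` with `t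
  -- X • rep X = X`.
  let rep : Finset D → Finset D := fun X => (Quotient.mk (MulAction.orbitRel H (Finset D)) X).out
  have hrep : ∀ X, ∃ h : H, h • rep X = X := fun X => by
    have h1 : (MulAction.orbitRel H (Finset D)) (rep X) X := Quotient.mk_out X
    obtain ⟨h, hh⟩ := (MulAction.orbitRel H (Finset D)).symm h1
    exact ⟨h, hh⟩
  have hrep_smul : ∀ (h : H) X, rep (h • X) = rep X := fun h X => by
    refine congrArg Quotient.out (Quotient.sound ?_)
    exact ⟨h, rfl⟩
  choose t ht using hrep
  have hc : ∀ X, (rep X).card = X.card := fun X => by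
    conv_rhs => rw [← ht X, Finset.card_smul_finset]
  refine ⟨⟨fun X => t X • S (rep X), fun X hX => ?_, fun X hX => ?_⟩, fun X hX => ?_,
    fun h X hX => ?_⟩
  · conv_rhs => rw [← ht X]
    exact Finset.smul_finset_subset_smul_finset (hsub _ (by rwa [hc]))
  · rw [Finset.card_smul_finset]
    exact hcard _ (by rwa [hc])
  · have := hP (t X) _ _ (hPS (rep X) (by rwa [hc]))
    rwa [ht] at this
  -- Both `h * t X` and `t (h • X)` carry the representative to `h • X`, so they differ by an
  -- element of its stabilizer, which preserves the subset chosen there.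
  · have h1 : (h * t X)⁻¹ * t (h • X) ∈ MulAction.stabilizer H (rep X) := by
      have h2 := ht (h • X)
      rw [hrep_smul] at h2
      rw [MulAction.mem_stabilizer_iff, mul_smul, h2, inv_smul_eq_iff, mul_smul, ht]
    have h2 := hstab (rep X) (by rwa [hc]) _ h1
    rw [mul_smul, inv_smul_eq_iff, mul_smul] at h2
    simp only [hrep_smul]
    exact h2

/-! ### The rotation group and its invariant subsets -/

/-- Permutations of `B ⊕ (I × ZMod p ⊕ T)` which fix `B`, rotate all the `p`-cycles simultaneously
and permute `T` arbitrarily. -/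
def rotationGroup (B I T : Type) (p : ℕ) : Subgroup (Equiv.Perm (B ⊕ (I × ZMod p ⊕ T))) where
  carrier := {h | ∃ (t : ZMod p) (ρ : Equiv.Perm T),
    h = Equiv.sumCongr (Equiv.refl B) (Equiv.sumCongr
      (Equiv.prodCongr (Equiv.refl I) (Equiv.addRight t)) ρ)}
  one_mem' := ⟨0, 1, by ext (_ | _ | _) <;> simp⟩
  mul_mem' := by
    rintro _ _ ⟨t, ρ, rfl⟩ ⟨t', ρ', rfl⟩
    refine ⟨t' + t, ρ * ρ', ?_⟩
    ext (_ | ⟨_, _⟩ | _) <;> simp [add_assoc]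
  inv_mem' := by
    rintro _ ⟨t, ρ, rfl⟩
    refine ⟨-t, ρ⁻¹, ?_⟩
    rw [inv_eq_iff_mul_eq_one]
    ext (_ | ⟨_, _⟩ | _) <;> simp

section Rotation

variable {B I T : Type} {p : ℕ}

/-- Rotation by `1` moves every point of a cycle, and a tail point can be swapped with another one.
This is what `n ≢ 1 (mod p)` is for: the tail will have `n % p` points. -/
theorem rotationGroup_exists_ne [Fact p.Prime] [Fintype T] (hT : Fintype.card T ≠ 1)
    (w : I × ZMod p ⊕ T) : ∃ h ∈ rotationGroup B I T p, h (Sum.inr w) ≠ Sum.inr w := by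
  rcases w with ⟨i, c⟩ | j
  · exact ⟨_, ⟨1, 1, rfl⟩, by simp⟩
  · obtain ⟨j', hj'⟩ : ∃ j', j' ≠ j := by
      by_contra! hall
      exact hT (Fintype.card_eq_one_iff.2 ⟨j, hall⟩)
    classical
    exact ⟨_, ⟨0, Equiv.swap j j', rfl⟩, by simpa using hj'⟩

open scoped Pointwise in
/-- A set with more than `m` elements has an `m`-element subset invariant under its stabilizer in
the rotation group. -/
theorem rotationGroup_exists_invariant [DecidableEq B] [DecidableEq I] [DecidableEq T]
    [Fact p.Prime] [Fintype T] (hT : Fintype.card T < p) {m : ℕ} (hm : 0 < m) (hpm : p ∣ m)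
    (X : Finset (B ⊕ (I × ZMod p ⊕ T))) (hX : m < X.card) :
    ∃ S ⊆ X, S.card = m ∧ ∀ h : rotationGroup B I T p, h • X = X → h • S = S := by
  obtain ⟨m', rfl⟩ := hpm
  have hm' : 0 < m' := Nat.pos_of_mul_pos_left hm
  have hp : p.Prime := Fact.out
  have hp0 := hp.pos
  have mem_iff : ∀ (h : rotationGroup B I T p) (Y : Finset (B ⊕ (I × ZMod p ⊕ T))),
      (∀ x ∈ Y, h • x ∈ Y) → h • Y = Y := fun h Y hY =>
    Finset.eq_of_subset_of_card_le
      (by intro x hx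
          obtain ⟨y, hy, rfl⟩ := Finset.mem_smul_finset.1 hx
          exact hY y hy) (Finset.card_smul_finset h Y).ge
  have mem_of : ∀ (h : rotationGroup B I T p), h • X = X → ∀ x ∈ X, h • x ∈ X := by
    intro h hh x hx
    rw [← hh]
    exact Finset.smul_mem_smul_finset hx
  let tail := X.filter fun x => ∃ j, x = Sum.inr (Sum.inr j)
  have htail : tail.card < p := by
    refine lt_of_le_of_lt ?_ hT
    rw [← Finset.card_univ, ← Finset.card_image_of_injective (f := fun j : T =>
      (Sum.inr (Sum.inr j) : B ⊕ (I × ZMod p ⊕ T))) _ (fun _ _ e => by simpa using e)]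
    refine Finset.card_le_card fun x hx => ?_
    obtain ⟨j, rfl⟩ := (Finset.mem_filter.1 hx).2
    simp
  -- If the stabilizer of `X` moves no cycle point, only tail points can move, and any `m`-subset of
  -- `X` containing its whole tail will do. The tail fits because it has fewer than `p ≤ m` points.
  by_cases htriv : ∀ h : rotationGroup B I T p, h • X = X → ∀ i c,
      h • (Sum.inr (Sum.inl (i, c)) : B ⊕ (I × ZMod p ⊕ T)) = Sum.inr (Sum.inl (i, c))
  · obtain ⟨S, htS, hSX, hS⟩ := Finset.exists_subsuperset_card_eq
      (Finset.filter_subset _ X : tail ⊆ X) (n := p * m')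
      (htail.le.trans (Nat.le_mul_of_pos_right p hm')) hX.le
    refine ⟨S, hSX, hS, fun h hh => mem_iff h S ?_⟩
    rintro (e | ⟨i, c⟩ | j) hx
    · obtain ⟨t, ρ, hρ⟩ := h.2
      have : h • (Sum.inl e : B ⊕ (I × ZMod p ⊕ T)) = Sum.inl e := by
        rw [Subgroup.smul_def, hρ]; rfl
      rwa [this]
    · rwa [htriv h hh]
    · refine htS (Finset.mem_filter.2 ⟨mem_of h hh _ (hSX hx), ?_⟩)
      obtain ⟨t, ρ, hρ⟩ := h.2
      exact ⟨ρ j, by rw [Subgroup.smul_def, hρ]; rfl⟩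
  push Not at htriv
  obtain ⟨h, hh, i₀, c₀, hne⟩ := htriv
  obtain ⟨t, ρ, hρ⟩ := h.2
  have hrot : ∀ i c, h • (Sum.inr (Sum.inl (i, c)) : B ⊕ (I × ZMod p ⊕ T)) =
      Sum.inr (Sum.inl (i, c + t)) := fun i c => by
    rw [Subgroup.smul_def, hρ]; rfl
  have ht : t ≠ 0 := by
    rintro rfl
    exact hne (by rw [hrot, add_zero])
  -- The multiples of `t ≠ 0` exhaust `ZMod p`, so `X` contains each cycle that it meets.
  have hclosed : ∀ i c c', Sum.inr (Sum.inl (i, c)) ∈ X → Sum.inr (Sum.inl (i, c')) ∈ X := by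
    intro i c c' hc
    have key : ∀ s : ℕ, Sum.inr (Sum.inl (i, c + s * t)) ∈ X := by
      intro s
      induction s with
      | zero => simpa using hc
      | succ s ih =>
        have := mem_of h hh _ ih
        rw [hrot] at this
        convert this using 4
        push_cast; ring
    have := key ((c' - c) / t).val
    rw [ZMod.natCast_zmod_val, div_mul_cancel₀ _ ht] at this
    simpa using this
  let rows : Finset I := (X.toRight.toLeft).image Prod.fst
  have hrows : ∀ i c, i ∈ rows ↔ Sum.inr (Sum.inl (i, c)) ∈ X := by
    intro i c
    simp only [rows, Finset.mem_image, Finset.mem_toLeft, Finset.mem_toRight, Prod.exists]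
    constructor
    · rintro ⟨i', c', h', rfl⟩
      exact hclosed _ _ _ h'
    · exact fun h' => ⟨i, c, h', rfl⟩
  let full : Finset I → Finset (B ⊕ (I × ZMod p ⊕ T)) := fun J =>
    (J ×ˢ (Finset.univ : Finset (ZMod p))).map
      (Function.Embedding.inl.trans Function.Embedding.inr)
  have hfull : ∀ J x, x ∈ full J ↔ ∃ i ∈ J, ∃ c, x = Sum.inr (Sum.inl (i, c)) := by
    intro J x
    simp only [full, Finset.mem_map, Finset.mem_product, Finset.mem_univ, and_true, Prod.exists,
      Function.Embedding.trans_apply, Function.Embedding.inl_apply, Function.Embedding.inr_apply]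
    constructor
    · rintro ⟨i, c, hi, rfl⟩
      exact ⟨i, hi, c, rfl⟩
    · rintro ⟨i, hi, c, rfl⟩
      exact ⟨i, c, hi, rfl⟩
  have hfullcard : ∀ J, (full J).card = p * J.card := fun J => by
    simp [full, ZMod.card, mul_comm]
  have hfullX : full rows ⊆ X := by
    intro x hx
    obtain ⟨i, hi, c, rfl⟩ := (hfull _ _).1 hx
    exact (hrows i c).1 hi
  -- Either `X` contains `m' = m / p` whole cycles, whose union has exactly `m` points, or it
  -- contains at most `m' - 1`. In the latter case these and the fewer than `p` tail points number
  -- at most `m`, and the remaining places are filled with points of `B`, which are all fixed.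
  by_cases hcard : m' ≤ rows.card
  · obtain ⟨J, hJ, hJc⟩ := Finset.exists_subset_card_eq hcard
    refine ⟨full J, fun x hx => ?_, by rw [hfullcard, hJc], fun k hk => mem_iff k _ ?_⟩
    · obtain ⟨i, hi, c, rfl⟩ := (hfull _ _).1 hx
      exact (hrows i c).1 (hJ hi)
    · intro x hx
      obtain ⟨i, hi, c, rfl⟩ := (hfull _ _).1 hx
      obtain ⟨t', ρ', hρ'⟩ := k.2
      exact (hfull _ _).2 ⟨i, hi, c + t', by rw [Subgroup.smul_def, hρ']; rfl⟩
  · have hle : (full rows ∪ tail).card ≤ p * m' := by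
      have h1 := Finset.card_union_le (full rows) tail
      rw [hfullcard] at h1
      have h2 : p * (rows.card + 1) ≤ p * m' := Nat.mul_le_mul_left p (by omega)
      rw [mul_add, mul_one] at h2
      omega
    obtain ⟨S, htS, hSX, hS⟩ := Finset.exists_subsuperset_card_eq
      (Finset.union_subset hfullX (Finset.filter_subset _ X)) hle hX.le
    refine ⟨S, hSX, hS, fun k hk => mem_iff k S ?_⟩
    obtain ⟨t', ρ', hρ'⟩ := k.2
    rintro (e | ⟨i, c⟩ | j) hx
    · have : k • (Sum.inl e : B ⊕ (I × ZMod p ⊕ T)) = Sum.inl e := by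
        rw [Subgroup.smul_def, hρ']; rfl
      rwa [this]
    · refine htS (Finset.mem_union_left _ ((hfull _ _).2 ⟨i, (hrows i c).2 (hSX hx), c + t', ?_⟩))
      rw [Subgroup.smul_def, hρ']; rfl
    · refine htS (Finset.mem_union_right _ (Finset.mem_filter.2 ⟨mem_of k hk _ (hSX hx), ρ' j, ?_⟩))
      rw [Subgroup.smul_def, hρ']; rfl

end Rotation

/-! ### Isomorphisms of submodels and embeddings in a generic model -/

namespace SelModel

variable {m : ℕ}

theorem IsIsoOn.comp {A B C : Type} [DecidableEq A] [DecidableEq B] [DecidableEq C]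
    {M : SelModel m A} {N : SelModel m B} {K : SelModel m C} {g : A → B} {g' : B → C}
    {P : Finset A} (hg : M.IsIsoOn N g P) (hg' : N.IsIsoOn K g' (P.image g)) :
    M.IsIsoOn K (g' ∘ g) P := by
  refine ⟨hg'.1.comp hg.1 fun x hx => Finset.mem_coe.2 (Finset.mem_image_of_mem g hx),
    fun X hX hc => ?_⟩
  have hcard : m < (X.image g).card := by
    rwa [Finset.card_image_of_injOn (hg.1.mono (Finset.coe_subset.2 hX))]
  rw [← Finset.image_image, hg'.2 _ (Finset.image_subset_image hX) hcard, hg.2 X hX hc,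
    Finset.image_image]

theorem IsIsoOn.mono {A B : Type} [DecidableEq A] [DecidableEq B]
    {M : SelModel m A} {N : SelModel m B} {g : A → B} {P Q : Finset A} (hg : M.IsIsoOn N g P)
    (hQ : Q ⊆ P) : M.IsIsoOn N g Q :=
  ⟨hg.1.mono (Finset.coe_subset.2 hQ), fun X hX hc => hg.2 X (hX.trans hQ) hc⟩

theorem isIsoOn_of_mem_aut {A : Type} [DecidableEq A] {M : SelModel m A} {π : Equiv.Perm A}
    (hπ : π ∈ M.aut) (P : Finset A) : M.IsIsoOn M π P :=
  ⟨π.injective.injOn, fun X _ hc => (hπ X hc).symm⟩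

/-- The inverse of an isomorphism of submodels. -/
theorem IsIsoOn.inv {A B : Type} [DecidableEq A] [DecidableEq B]
    {M : SelModel m A} {N : SelModel m B} {g : A → B} {g' : B → A} {P : Finset A}
    (hg : M.IsIsoOn N g P) (h : ∀ a ∈ P, g' (g a) = a) : N.IsIsoOn M g' (P.image g) := by
  have hinv : ∀ Y ⊆ P, (Y.image g).image g' = Y := fun Y hY => by
    rw [Finset.image_image]
    conv_rhs => rw [← Finset.image_id (s := Y)]
    exact Finset.image_congr fun a ha => h a (hY ha)
  refine ⟨?_, fun X hX hc => ?_⟩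
  · intro x hx y hy hxy
    obtain ⟨a, ha, rfl⟩ := Finset.mem_image.1 (Finset.mem_coe.1 hx)
    obtain ⟨b, hb, rfl⟩ := Finset.mem_image.1 (Finset.mem_coe.1 hy)
    rw [h a ha, h b hb] at hxy
    rw [hxy]
  · obtain ⟨Y, hY, rfl⟩ := Finset.subset_image_iff.1 hX
    have hY' : Y ⊆ P := hY
    have hcY : m < Y.card := lt_of_lt_of_le hc Finset.card_image_le
    rw [hinv Y hY', hg.2 Y hY' hcY, hinv _ ((M.sel_subset Y hcY).trans hY')]

/-- Two embeddings of a finite model in a generic one differ by an automorphism. -/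
theorem IsGeneric.exists_aut {F : SelModel m ℕ} (hF : F.IsGeneric) {D : Type} [Nonempty D]
    [DecidableEq D] {M : SelModel m D} {g g' : D → ℕ} {P : Finset D} (hg : M.IsIsoOn F g P)
    (hg' : M.IsIsoOn F g' P) : ∃ π ∈ F.aut, ∀ d ∈ P, π (g d) = g' d := by
  have hleft : ∀ d ∈ P, Function.invFunOn g P (g d) = d := fun d hd =>
    hg.1.leftInvOn_invFunOn (Finset.mem_coe.2 hd)
  have himg : (P.image g).image (Function.invFunOn g P) = P := by
    rw [Finset.image_image]
    conv_rhs => rw [← Finset.image_id (s := P)]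
    exact Finset.image_congr fun a ha => hleft a ha
  -- `g'` composed with the inverse of `g` is an isomorphism between finite submodels of `F`, which
  -- homogeneity extends.
  obtain ⟨π, hπ, hπg⟩ := hF.homogeneous _ _ ((hg.inv hleft).comp (himg.symm ▸ hg'))
  refine ⟨π, hπ, fun d hd => ?_⟩
  rw [hπg _ (Finset.mem_image_of_mem g hd), Function.comp_apply, hleft d hd]

/-- Every nonempty finite model embeds in a generic one. -/
theorem IsGeneric.exists_embedding {F : SelModel m ℕ} (hF : F.IsGeneric) {D : Type} [Fintype D]
    [Nonempty D] [DecidableEq D] (M : SelModel m D) :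
    ∃ g : D → ℕ, M.IsIsoOn F g Finset.univ := by
  let e := Fintype.equivFin D
  let M' : SelModel m (Fin (Fintype.card D)) :=
    { sel := fun X => (M.sel (X.image e.symm)).image e
      sel_subset := fun X hX => by
        have := M.sel_subset (X.image e.symm)
          (by rwa [Finset.card_image_of_injective _ e.symm.injective])
        refine (Finset.image_subset_image this).trans ?_
        rw [Finset.image_image]
        simp
      card_sel := fun X hX => by
        rw [Finset.card_image_of_injective _ e.injective]
        exact M.card_sel _ (by rwa [Finset.card_image_of_injective _ e.symm.injective]) }
  obtain ⟨_, g, hg, -⟩ := (hF.universal _ Fintype.card_pos M').nonempty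
  have he : M.IsIsoOn M' e Finset.univ := by
    refine ⟨e.injective.injOn, fun X _ _ => ?_⟩
    simp only [M', Finset.image_image]
    simp
  exact ⟨g ∘ e, he.comp (hg.mono (Finset.subset_univ _))⟩

/-- A finite model which contains a submodel of a generic model `F` embeds in `F` over it. -/
theorem IsGeneric.exists_embedding_over {F : SelModel m ℕ} (hF : F.IsGeneric) {E : Finset ℕ}
    {D : Type} [Fintype D] [Nonempty D] [DecidableEq D] (M : SelModel m D) (ι : E → D) (v : D → ℕ)
    (hv : ∀ a, v (ι a) = a) (hι : M.IsIsoOn F v (Finset.univ.image ι)) :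
    ∃ g : D → ℕ, M.IsIsoOn F g Finset.univ ∧ ∀ a, g (ι a) = a := by
  obtain ⟨g, hg⟩ := hF.exists_embedding M
  -- An arbitrary embedding `g` is corrected by an automorphism that moves the copy of `E` back to
  -- `E`.
  obtain ⟨π, hπ, hπg⟩ := hF.exists_aut (hg.mono (Finset.subset_univ _)) hι
  refine ⟨π ∘ g, hg.comp (isIsoOn_of_mem_aut hπ _), fun a => ?_⟩
  rw [Function.comp_apply, hπg _ (Finset.mem_image_of_mem ι (Finset.mem_univ a)), hv]

end SelModel

/-! ### The action of permutations on the universe, and symmetric objects -/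

namespace ZFA

variable {A : Type}

/-- An atom as an object of the universe. -/
def atom (a : A) : ZFA.{u} A := Quotient.mk _ (PreZFA.atom a)

/-- A set of atoms as an object of the universe. -/
def ofSet (s : Set A) : ZFA.{u} A :=
  Quotient.mk _ (PreZFA.set (ULift.{u} s) fun a => PreZFA.atom a.down.1)

theorem atom_injective : Function.Injective (atom : A → ZFA.{u} A) :=
  fun _ _ h => Quotient.exact h

theorem not_mem_atom (x : ZFA.{u} A) (a : A) : ¬ Mem x (atom a) := by
  induction x using Quotient.inductionOn with
  | h x => exact fun h => h

theorem not_isAtom_ofSet (s : Set A) : ¬ IsAtom (ofSet.{u} s) := fun h => h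

theorem mem_ofSet {x : ZFA.{u} A} {s : Set A} : Mem x (ofSet s) ↔ ∃ a ∈ s, x = atom a := by
  induction x using Quotient.inductionOn with
  | h x =>
    constructor
    · rintro ⟨⟨a, ha⟩, h⟩
      exact ⟨a, ha, Quotient.sound h⟩
    · rintro ⟨a, ha, h⟩
      exact ⟨⟨a, ha⟩, Quotient.exact h⟩

theorem map_one (x : ZFA.{u} A) : map 1 x = x := by
  induction x using Quotient.inductionOn with
  | h x =>
    refine congrArg (Quotient.mk _) ?_
    induction x with
    | atom a => rfl
    | set ι f ih => exact congrArg (PreZFA.set ι) (funext ih)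

theorem map_mul (π ρ : Equiv.Perm A) (x : ZFA.{u} A) : map (π * ρ) x = map π (map ρ x) := by
  induction x using Quotient.inductionOn with
  | h x =>
    refine congrArg (Quotient.mk _) ?_
    induction x with
    | atom a => rfl
    | set ι f ih => exact congrArg (PreZFA.set ι) (funext ih)

theorem map_inv_map (π : Equiv.Perm A) (x : ZFA.{u} A) : map π⁻¹ (map π x) = x := by
  rw [← map_mul, inv_mul_cancel, map_one]

theorem map_map_inv (π : Equiv.Perm A) (x : ZFA.{u} A) : map π (map π⁻¹ x) = x := by
  rw [← map_mul, mul_inv_cancel, map_one]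

theorem map_atom (π : Equiv.Perm A) (a : A) : map π (atom.{u} a) = atom (π a) := rfl

theorem map_ofSet (π : Equiv.Perm A) (s : Set A) : map π (ofSet.{u} s) = ofSet (π '' s) := by
  refine Quotient.sound ⟨?_, ?_⟩
  · rintro ⟨a, ha⟩
    exact ⟨⟨π a, a, ha, rfl⟩, PreZFA.Equiv.refl _⟩
  · rintro ⟨_, a, ha, rfl⟩
    exact ⟨⟨a, ha⟩, PreZFA.Equiv.refl _⟩

theorem mem_map {π : Equiv.Perm A} {x y : ZFA.{u} A} (h : Mem x y) : Mem (map π x) (map π y) := by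
  induction x using Quotient.inductionOn with
  | h x =>
    induction y using Quotient.inductionOn with
    | h y =>
      cases y with
      | atom a => exact h
      | set ι f =>
        obtain ⟨i, hi⟩ := h
        exact ⟨i, PreZFA.map_congr π hi⟩

theorem mem_map_iff {π : Equiv.Perm A} {x y : ZFA.{u} A} :
    Mem (map π x) (map π y) ↔ Mem x y :=
  ⟨fun h => by simpa only [map_inv_map] using mem_map (π := π⁻¹) h, mem_map⟩

theorem isAtom_map_iff {π : Equiv.Perm A} {x : ZFA.{u} A} : IsAtom (map π x) ↔ IsAtom x := by
  induction x using Quotient.inductionOn with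
  | h x => cases x <;> exact Iff.rfl

variable {G : Subgroup (Equiv.Perm A)}

/-- If `E` supports `x`, then `π E` supports `π x`: when `ρ` fixes `π E` pointwise, `π⁻¹ * ρ * π`
fixes `E` pointwise. -/
theorem IsSymmetric.map {π : Equiv.Perm A} (hπ : π ∈ G) {x : ZFA.{u} A} (hx : IsSymmetric G x) :
    IsSymmetric G (ZFA.map π x) := by
  obtain ⟨E, hE⟩ := hx
  refine ⟨E.map π.toEmbedding, fun ρ hρ hfix => ?_⟩
  have := hE (π⁻¹ * ρ * π) (G.mul_mem (G.mul_mem (G.inv_mem hπ) hρ) hπ) fun a ha => by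
    have := hfix (π a) (Finset.mem_map.2 ⟨a, ha, rfl⟩)
    simp [this]
  rw [map_mul, map_mul] at this
  conv_rhs => rw [← this, map_map_inv]

theorem IsHereditarilySymmetric.map {π : Equiv.Perm A} (hπ : π ∈ G) {x : ZFA.{u} A}
    (hx : IsHereditarilySymmetric G x) : IsHereditarilySymmetric G (ZFA.map π x) := by
  induction hx with
  | intro x hx _ ih =>
    refine ⟨_, hx.map hπ, fun y hy => ?_⟩
    have := ih (ZFA.map π⁻¹ y) (by rwa [← mem_map_iff (π := π), map_map_inv])
    rwa [map_map_inv] at this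

theorem IsHereditarilySymmetric.isSymmetric {x : ZFA.{u} A} (hx : IsHereditarilySymmetric G x) :
    IsSymmetric G x := by
  cases hx; assumption

theorem isHereditarilySymmetric_atom (a : A) : IsHereditarilySymmetric G (atom.{u} a) :=
  ⟨_, ⟨{a}, fun π _ h => by rw [map_atom, h a (Finset.mem_singleton_self a)]⟩,
    fun y hy => (not_mem_atom y a hy).elim⟩

theorem isHereditarilySymmetric_ofSet {s : Set A}
    (hs : ∃ E : Finset A, ∀ π ∈ G, (∀ a ∈ E, π a = a) → π '' s = s) :
    IsHereditarilySymmetric G (ofSet.{u} s) := by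
  obtain ⟨E, hE⟩ := hs
  refine ⟨_, ⟨E, fun π hπ h => by rw [map_ofSet, hE π hπ h]⟩, fun y hy => ?_⟩
  obtain ⟨a, -, rfl⟩ := mem_ofSet.1 hy
  exact isHereditarilySymmetric_atom a

theorem isHereditarilySymmetric_ofSet_univ :
    IsHereditarilySymmetric G (ofSet.{u} (Set.univ : Set A)) :=
  isHereditarilySymmetric_ofSet ⟨∅, fun π _ _ => by simp⟩

theorem isHereditarilySymmetric_ofSet_finset (s : Finset A) :
    IsHereditarilySymmetric G (ofSet.{u} (s : Set A)) :=
  isHereditarilySymmetric_ofSet ⟨s, fun π _ h => by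
    rw [Set.image_congr (g := id) fun a ha => h a ha, Set.image_id]⟩

end ZFA

/-! ### Kuratowski pairs inside a structure -/

namespace SetStructure

variable {M : SetStructure.{u}}

/-- Surjectivity is needed because the definition quantifies over all objects of the structure. -/
theorem IsUPair.map {φ : M.carrier → M.carrier} (hφ : Function.Surjective φ)
    (hmem : ∀ x y, M.mem (φ x) (φ y) ↔ M.mem x y) (hatom : ∀ x, M.isAtom (φ x) ↔ M.isAtom x)
    (hinj : Function.Injective φ) {c a b : M.carrier} (h : M.IsUPair c a b) :
    M.IsUPair (φ c) (φ a) (φ b) := by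
  refine ⟨fun hc => h.1 ((hatom c).1 hc), fun t => ?_⟩
  obtain ⟨s, rfl⟩ := hφ t
  rw [hmem, h.2, hinj.eq_iff, hinj.eq_iff]

theorem IsPair.map {φ : M.carrier → M.carrier} (hφ : Function.Surjective φ)
    (hmem : ∀ x y, M.mem (φ x) (φ y) ↔ M.mem x y) (hatom : ∀ x, M.isAtom (φ x) ↔ M.isAtom x)
    (hinj : Function.Injective φ) {q a b : M.carrier} (h : M.IsPair q a b) :
    M.IsPair (φ q) (φ a) (φ b) := by
  obtain ⟨c, d, hc, hd, hq⟩ := h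
  exact ⟨φ c, φ d, hc.map hφ hmem hatom hinj, hd.map hφ hmem hatom hinj,
    hq.map hφ hmem hatom hinj⟩

theorem IsUPair.eq_or_eq {c a b a' b' : M.carrier} (h : M.IsUPair c a b)
    (h' : M.IsUPair c a' b') : (a = a' ∧ b = b') ∨ (a = b' ∧ b = a') := by
  have h1 := (h'.2 a).1 ((h.2 a).2 (Or.inl rfl))
  have h2 := (h'.2 b).1 ((h.2 b).2 (Or.inr rfl))
  have h3 := (h.2 a').1 ((h'.2 a').2 (Or.inl rfl))
  have h4 := (h.2 b').1 ((h'.2 b').2 (Or.inr rfl))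
  grind

theorem IsPair.eq {q a b a' b' : M.carrier} (h : M.IsPair q a b) (h' : M.IsPair q a' b') :
    a = a' ∧ b = b' := by
  obtain ⟨c, d, hc, hd, hq⟩ := h
  obtain ⟨c', d', hc', hd', hq'⟩ := h'
  rcases hq.eq_or_eq hq' with ⟨rfl, rfl⟩ | ⟨rfl, rfl⟩
  · have h1 := hc.eq_or_eq hc'
    have h2 := hd.eq_or_eq hd'
    grind
  · have h1 := hc.eq_or_eq hd'
    have h2 := hd.eq_or_eq hc'
    grind

end SetStructure

/-! ### Choice functions and fixed atoms -/

namespace permutationModel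

variable {A : Type} {G : Subgroup (Equiv.Perm A)}

/-- The action of an element of the group on the permutation model. -/
def map {π : Equiv.Perm A} (hπ : π ∈ G) (x : (permutationModel.{u} G).carrier) :
    (permutationModel.{u} G).carrier :=
  ⟨ZFA.map π x.1, x.2.map hπ⟩

/-- Elements of `G` act on the model as automorphisms of its set structure, so they preserve what is
defined inside it. -/
theorem isPair_map {π : Equiv.Perm A} (hπ : π ∈ G) {q a b : (permutationModel.{u} G).carrier}
    (h : (permutationModel.{u} G).IsPair q a b) :
    (permutationModel.{u} G).IsPair (map hπ q) (map hπ a) (map hπ b) := by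
  have h1 : Function.RightInverse (map.{u} (G.inv_mem hπ)) (map hπ) :=
    fun x => Subtype.ext (ZFA.map_map_inv π x.1)
  have h2 : Function.LeftInverse (map.{u} (G.inv_mem hπ)) (map hπ) :=
    fun x => Subtype.ext (ZFA.map_inv_map π x.1)
  exact h.map h1.surjective (fun _ _ => ZFA.mem_map_iff) (fun _ => ZFA.isAtom_map_iff) h2.injective

/-- A choice function on `[y]^n` with support `E` selects from a finite set `s` of atoms an atom
fixed by every element of the group which fixes `E` pointwise and maps `s` to itself. -/
theorem exists_fixed_atom {n : ℕ} {f y : (permutationModel.{u} G).carrier}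
    (hf : (permutationModel.{u} G).IsChoiceFunction n f y) {E : Finset A}
    (hE : ∀ π ∈ G, (∀ a ∈ E, π a = a) → ZFA.map π f.1 = f.1)
    (s : Finset A) (hs : s.card = n) (hsy : ∀ a ∈ s, ZFA.Mem (ZFA.atom a) y.1) :
    ∃ a ∈ s, ∀ π ∈ G, (∀ e ∈ E, π e = e) → π '' (s : Set A) = s → π a = a := by
  let z : (permutationModel.{u} G).carrier :=
    ⟨ZFA.ofSet (s : Set A), ZFA.isHereditarilySymmetric_ofSet_finset s⟩
  let at' : A → (permutationModel.{u} G).carrier := fun a =>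
    ⟨ZFA.atom a, ZFA.isHereditarilySymmetric_atom a⟩
  have hat : Function.Injective at' := fun a b h => ZFA.atom_injective (congrArg Subtype.val h)
  have hmemz : {t | (permutationModel.{u} G).mem t z} = at' '' (s : Set A) := by
    ext t
    refine (ZFA.mem_ofSet (x := t.1)).trans ⟨?_, ?_⟩
    · rintro ⟨a, ha, h⟩
      exact ⟨a, ha, Subtype.ext h.symm⟩
    · rintro ⟨a, ha, rfl⟩
      exact ⟨a, ha, rfl⟩
  have hz : (permutationModel.{u} G).IsSubsetOfCard n z y := by
    refine ⟨⟨ZFA.not_isAtom_ofSet.{u} (s : Set A), fun t ht => ?_⟩, ?_, ?_⟩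
    · obtain ⟨a, ha, h⟩ := ZFA.mem_ofSet.1 ht
      change ZFA.Mem t.1 y.1
      rw [h]
      exact hsy a ha
    · rw [hmemz]
      exact s.finite_toSet.image _
    · rw [hmemz, Set.ncard_image_of_injective _ hat, Set.ncard_coe_finset, hs]
  obtain ⟨w, ⟨q, hq, hqzw⟩, huniq⟩ := hf.2.2 z hz
  -- That the value `w` lies in `z` is read off from the clause on the members of `f`, by
  -- injectivity of pairs.
  obtain ⟨z', w', -, hw', hq'⟩ := hf.2.1 q hq
  obtain ⟨rfl, rfl⟩ := hqzw.eq hq'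
  obtain ⟨a, ha, hwa⟩ := ZFA.mem_ofSet.1 hw'
  refine ⟨a, ha, fun π hπ hfix hπs => ?_⟩
  -- As `π` fixes `z` and `f`, the pair `(z, π w)` also belongs to `f`, so `π w = w` by uniqueness
  -- of the value.
  have hmap := isPair_map hπ hqzw
  have hzfix : map hπ z = z := Subtype.ext (by
    change ZFA.map π (ZFA.ofSet _) = ZFA.ofSet _
    rw [ZFA.map_ofSet, hπs])
  rw [hzfix] at hmap
  have hqf : (permutationModel.{u} G).mem (map hπ q) f := by
    have := ZFA.mem_map (π := π) hq
    rwa [hE π hπ hfix] at this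
  have hw := congrArg Subtype.val (huniq _ ⟨_, hqf, hmap⟩)
  change ZFA.map π w.1 = w.1 at hw
  rw [hwa, ZFA.map_atom] at hw
  exact ZFA.atom_injective hw

end permutationModel

/-! ### The invariant finite model over the support -/

section Rotation

variable {B I T : Type} {p : ℕ}

theorem rotationGroup_smul_inl (h : rotationGroup B I T p) (e : B) :
    h • (Sum.inl e : B ⊕ (I × ZMod p ⊕ T)) = Sum.inl e := by
  obtain ⟨t, ρ, hρ⟩ := h.2
  rw [Subgroup.smul_def, hρ]; rfl

theorem rotationGroup_smul_inr (h : rotationGroup B I T p) (x : I × ZMod p ⊕ T) :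
    ∃ x', h • (Sum.inr x : B ⊕ (I × ZMod p ⊕ T)) = Sum.inr x' := by
  obtain ⟨t, ρ, hρ⟩ := h.2
  rw [Subgroup.smul_def, hρ]; exact ⟨_, rfl⟩

end Rotation

open scoped Pointwise in
/-- A finite model containing the submodel `B` of `F`, invariant under the rotation group, in which
every point outside of `B` realizes over `B` the type of `b`. -/
theorem SelModel.exists_rotation_model {m p : ℕ} (F : SelModel m ℕ) (E : Finset ℕ) (b : ℕ)
    {I T : Type} [DecidableEq I] [DecidableEq T] [Fact p.Prime] [Fintype T]
    (hT : Fintype.card T < p) (hm : 0 < m) (hpm : p ∣ m) :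
    ∃ M : SelModel m (E ⊕ (I × ZMod p ⊕ T)),
      (∀ P : Finset (E ⊕ (I × ZMod p ⊕ T)),
        Set.InjOn (Sum.elim Subtype.val fun _ => b : E ⊕ (I × ZMod p ⊕ T) → ℕ) P →
        M.IsIsoOn F (Sum.elim Subtype.val fun _ => b) P) ∧
      ∀ h ∈ rotationGroup E I T p, ∀ P, M.IsIsoOn M h P := by
  -- `v` collapses all new points to `b`; it is invariant under the group.
  set v : E ⊕ (I × ZMod p ⊕ T) → ℕ := Sum.elim Subtype.val fun _ => b with hv
  have hinv : ∀ (h : rotationGroup E I T p) x, v (h • x) = v x := by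
    rintro h (e | x)
    · rw [rotationGroup_smul_inl]
    · obtain ⟨x', hx'⟩ := rotationGroup_smul_inr h x
      rw [hx']; rfl
  have himg : ∀ (h : rotationGroup E I T p) (X : Finset (E ⊕ (I × ZMod p ⊕ T))),
      (h • X).image v = X.image v := fun h X => by
    rw [Finset.smul_finset_def, Finset.image_image]
    exact Finset.image_congr fun x _ => hinv h x
  have hinj : ∀ (h : rotationGroup E I T p) (X : Finset (E ⊕ (I × ZMod p ⊕ T))),
      Set.InjOn v ((h • X : Finset _) : Set _) → Set.InjOn v X := by
    intro h X hX x hx y hy hxy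
    refine MulAction.injective h (hX (Finset.smul_mem_smul_finset hx)
      (Finset.smul_mem_smul_finset hy) ?_)
    change v (h • x) = v (h • y)
    rw [hinv, hinv, hxy]
  -- Where `v` is injective, `X` has at most one new point and its selection is pulled back from `F`
  -- along `v`, which is invariant because `v` is. On all other `X` the selection is unconstrained,
  -- and `rotationGroup_exists_invariant` applies.
  obtain ⟨M, hM, hMeq⟩ := SelModel.exists_equivariant (m := m) (H := rotationGroup E I T p)
    (fun X S => Set.InjOn v X → S.image v = F.sel (X.image v))
    (fun h X S hS hX => by rw [himg, himg]; exact hS (hinj h X hX))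
    (fun X hX => by
      by_cases hi : Set.InjOn v X
      · have hcard : m < (X.image v).card := by rwa [Finset.card_image_of_injOn hi]
        have hSimg : (X.filter fun x => v x ∈ F.sel (X.image v)).image v =
            F.sel (X.image v) := by
          ext a
          simp only [Finset.mem_image, Finset.mem_filter]
          constructor
          · rintro ⟨x, ⟨-, hx⟩, rfl⟩
            exact hx
          · intro ha
            obtain ⟨x, hx, rfl⟩ := Finset.mem_image.1 (F.sel_subset _ hcard ha)
            exact ⟨x, ⟨hx, ha⟩, rfl⟩
        refine ⟨X.filter fun x => v x ∈ F.sel (X.image v), Finset.filter_subset _ _, ?_,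
          fun _ => hSimg, fun h hh => ?_⟩
        · rw [← Finset.card_image_of_injOn (hi.mono (Finset.coe_subset.2
            (Finset.filter_subset _ _))), hSimg, F.card_sel _ hcard]
        · refine Finset.eq_of_subset_of_card_le (fun x hx => ?_) (Finset.card_smul_finset _ _).ge
          obtain ⟨y, hy, rfl⟩ := Finset.mem_smul_finset.1 hx
          rw [Finset.mem_filter] at hy ⊢
          refine ⟨?_, by rw [hinv]; exact hy.2⟩
          have := Finset.smul_mem_smul_finset (a := h) hy.1
          rwa [hh] at this
      · obtain ⟨S, hSX, hS, hstab⟩ := rotationGroup_exists_invariant hT hm hpm X hX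
        exact ⟨S, hSX, hS, fun h' => absurd h' hi, hstab⟩)
  refine ⟨M, fun P hP => ⟨hP, fun X hX hc => ?_⟩, fun h hh P => ⟨h.injective.injOn,
    fun X hX hc => hMeq ⟨h, hh⟩ X hc⟩⟩
  exact (hM X hc (hP.mono (Finset.coe_subset.2 hX))).symm

/-! ### The failure of Ramsey choice -/

theorem mainTheorem4 (m n : ℕ) (hm : 0 < m) (hn : 0 < n)
    (h : ∃ p : ℕ, p.Prime ∧ p ∣ m ∧ ¬ n ≡ 1 [MOD p])
    (F : SelModel m ℕ) (hF : F.IsGeneric) :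
    ¬ (MOD.{u} F).RC n := by
  obtain ⟨p, hp, hpm, hnp⟩ := h
  have : Fact p.Prime := ⟨hp⟩
  intro hRC
  have hatoms : (MOD.{u} F).IsInfiniteSet
      ⟨ZFA.ofSet Set.univ, ZFA.isHereditarilySymmetric_ofSet_univ⟩ := by
    refine ⟨ZFA.not_isAtom_ofSet.{u} (Set.univ : Set ℕ), ?_⟩
    let at' : ℕ → (MOD.{u} F).carrier := fun a =>
      ⟨ZFA.atom a, ZFA.isHereditarilySymmetric_atom a⟩
    have hat : Function.Injective at' := fun a b h => ZFA.atom_injective (congrArg Subtype.val h)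
    refine (Set.infinite_range_of_injective hat).mono ?_
    rintro _ ⟨a, rfl⟩
    exact ZFA.mem_ofSet.2 ⟨a, Set.mem_univ a, rfl⟩
  obtain ⟨y, hyA, hyinf, f, hf⟩ := hRC _ hatoms
  obtain ⟨Ey, hEy⟩ := y.2.isSymmetric
  obtain ⟨Ef, hEf⟩ := f.2.isSymmetric
  set E := Ey ∪ Ef with hE
  obtain ⟨b, hbE, hby⟩ : ∃ b ∉ E, ZFA.Mem (ZFA.atom b) y.1 := by
    by_contra! hall
    -- Otherwise all members of `y` would be atoms of the finite set `E`.
    refine hyinf.2 (((E.finite_toSet.image ZFA.atom).preimage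
      Subtype.val_injective.injOn).subset fun t ht => ?_)
    obtain ⟨a, -, ha⟩ := ZFA.mem_ofSet.1 (hyA.2 t ht)
    refine ⟨a, ?_, ha.symm⟩
    by_contra haE
    exact hall a haE (ha ▸ ht)
  let Z := Fin (n / p) × ZMod p ⊕ Fin (n % p)
  have hZ : Fintype.card Z = n := by
    simp only [Z, Fintype.card_sum, Fintype.card_prod, Fintype.card_fin, ZMod.card]
    exact Nat.div_add_mod' n p
  have : Nonempty Z := Fintype.card_pos_iff.1 (hZ.symm ▸ hn)
  obtain ⟨M, hMv, hMrot⟩ := F.exists_rotation_model E b (I := Fin (n / p)) (T := Fin (n % p))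
    (by simpa using Nat.mod_lt n hp.pos) hm hpm
  obtain ⟨g, hg, hgE⟩ := hF.exists_embedding_over M Sum.inl _ (fun _ => rfl) (hMv _ (by
    intro x hx x' hx' h
    obtain ⟨e, -, rfl⟩ := Finset.mem_image.1 (Finset.mem_coe.1 hx)
    obtain ⟨e', -, rfl⟩ := Finset.mem_image.1 (Finset.mem_coe.1 hx')
    exact congrArg Sum.inl (Subtype.ext h)))
  have hginj : Function.Injective g := fun x x' h => hg.1 (by simp) (by simp) h
  -- Over `E`, the atoms `g (Sum.inr x)` and `b` have the same type, so some automorphism fixing `E`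
  -- pointwise takes the first to the second. As `E` contains a support of `y`, membership in `y`
  -- transfers.
  have hgy : ∀ x : Z, ZFA.Mem (ZFA.atom (g (Sum.inr x))) y.1 := by
    intro x
    have hinj : Set.InjOn (Sum.elim Subtype.val fun _ => b : E ⊕ Z → ℕ)
        (insert (Sum.inr x) (Finset.univ.image Sum.inl) : Finset (E ⊕ Z)) := by
      rintro (e | w) hw (e' | w') hw' h
      · exact congrArg Sum.inl (Subtype.ext h)
      · exact absurd (show (e : ℕ) = b from h) (ne_of_mem_of_not_mem e.2 hbE)
      · exact absurd (show (e' : ℕ) = b from h.symm) (ne_of_mem_of_not_mem e'.2 hbE)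
      · have hwx : w = x := by simpa using hw
        have hwx' : w' = x := by simpa using hw'
        rw [hwx, hwx']
    obtain ⟨π, hπ, hπ'⟩ := hF.exists_aut (hg.mono (Finset.subset_univ _)) (hMv _ hinj)
    have hfix : ∀ a ∈ E, π a = a := fun a ha => by
      have := hπ' (Sum.inl ⟨a, ha⟩) (by simp)
      rwa [hgE] at this
    have hx := hπ' (Sum.inr x) (by simp)
    rw [← ZFA.mem_map_iff (π := π), ZFA.map_atom, hx,
      hEy π hπ fun a ha => hfix a (Finset.mem_union_left _ ha)]
    exact hby
  obtain ⟨a, ha, hafix⟩ := permutationModel.exists_fixed_atom hf hEf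
    (Finset.univ.image fun x : Z => g (Sum.inr x))
    ((Finset.card_image_of_injective _ (hginj.comp Sum.inr_injective)).trans hZ)
    (fun a ha => by
      obtain ⟨x, -, rfl⟩ := Finset.mem_image.1 ha
      exact hgy x)
  obtain ⟨w, -, rfl⟩ := Finset.mem_image.1 ha
  obtain ⟨σ, hσ, hσw⟩ := rotationGroup_exists_ne (B := E) (I := Fin (n / p)) (T := Fin (n % p))
    (p := p) (by
      rw [Fintype.card_fin]
      intro h
      exact hnp (by rw [Nat.ModEq, h, Nat.mod_eq_of_lt hp.one_lt])) w
  -- Both `g` and `g ∘ σ` embed `M` in `F`, so some automorphism `π` acts on the image of `g` as `σ`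
  -- does on `M`. It remains to see that `π` fixes `Ef` pointwise and preserves the `n`-set,
  -- although it moves the chosen atom.
  obtain ⟨π, hπ, hπg⟩ := hF.exists_aut hg
    ((hMrot σ hσ Finset.univ).comp (hg.mono (Finset.subset_univ _)))
  have hπ' : ∀ d, π (g d) = g (σ d) := fun d => hπg d (Finset.mem_univ d)
  refine hσw (hginj ((hπ' _).symm.trans (hafix π hπ (fun e he => ?_) ?_)))
  · have heE : e ∈ E := Finset.mem_union_right _ he
    have h2 := hπ' (Sum.inl ⟨e, heE⟩)
    rw [show σ (Sum.inl ⟨e, heE⟩) = Sum.inl ⟨e, heE⟩ from rotationGroup_smul_inl ⟨σ, hσ⟩ _,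
      hgE] at h2
    exact h2
  · rw [← Finset.coe_image]
    refine congrArg _ (Finset.eq_of_subset_of_card_le (fun a ha => ?_)
      (Finset.card_image_of_injective _ π.injective).ge)
    obtain ⟨_, hc, rfl⟩ := Finset.mem_image.1 ha
    obtain ⟨x, -, rfl⟩ := Finset.mem_image.1 hc
    obtain ⟨x', hx'⟩ := rotationGroup_smul_inr ⟨σ, hσ⟩ x
    rw [hπ', show σ (Sum.inr x) = Sum.inr x' from hx']
    exact Finset.mem_image_of_mem (fun x : Z => g (Sum.inr x)) (Finset.mem_univ x')
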